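/- Let $H$ be a complex Hilbert space (of any dimension, finite or infinite, separable or not), let $B(H)$ be the algebra of bounded linear operators on $H$, and let $\phi : B(H) \to B(H)$ be a linear map that is positive (it sends positive operators to positive operators) and unital ($\phi(1) = 1$). Suppose that for some natural number $k$ with $1 \le k < \dim H$, $\phi$ maps the set $\mathcal P_k$ of all orthogonal projections of rank $k$ in $B(H)$ onto itself, i.e. $\phi(\mathcal P_k) = \mathcal P_k$. Fix an orthonormal basis $(e_i)_{i \in I}$ of $H$, and for $a \in B(H)$ let $a^t \in B(H)$ be the transpose of $a$ with respect to it, i.e. $\langle a^t e_j, e_i\rangle = \langle a e_i, e_j\rangle$ for all $i, j \in I$. Then there is a unitary operator $U$ on $H$ such that either $\phi(a) = U a U^*$ for all $a \in B(H)$, or $\phi(a) = U a^t U^*$ for all $a \in B(H)$. -/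

import Mathlib

noncomputable section

/-- The orthogonal (self-adjoint, idempotent) projections of rank `k` in `B(H)`. -/
def rankProjections (H : Type*) [NormedAddCommGroup H] [InnerProductSpace ℂ H]
    [CompleteSpace H] (k : ℕ) : Set (H →L[ℂ] H) :=
  {p | IsStarProjection p ∧ LinearMap.rank (p : H →ₗ[ℂ] H) = (k : Cardinal)}

/-- Complex conjugation of the coordinates with respect to an orthonormal basis `b`:
`∑ cᵢ bᵢ ↦ ∑ (conj cᵢ) bᵢ`. -/
def basisConj {H : Type*} [NormedAddCommGroup H] [InnerProductSpace ℂ H]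
    {ι : Type*} (b : HilbertBasis ι ℂ H) : H ≃ₗᵢ⋆[ℂ] H :=
  (b.repr.trans (starₗᵢ ℂ : lp (fun _ : ι => ℂ) 2 ≃ₗᵢ⋆[ℂ] lp (fun _ : ι => ℂ) 2)).trans
    b.repr.symm

/-- The transpose of `a ∈ B(H)` with respect to an orthonormal basis `b`: the adjoint conjugated
by coordinatewise complex conjugation. See `inner_basisTranspose` for its matrix entries. -/
def basisTranspose {H : Type*} [NormedAddCommGroup H] [InnerProductSpace ℂ H]
    [CompleteSpace H] {ι : Type*} (b : HilbertBasis ι ℂ H) (a : H →L[ℂ] H) : H →L[ℂ] H :=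
  ((basisConj b : H →L⋆[ℂ] H).comp (ContinuousLinearMap.adjoint a)).comp
    (basisConj b : H →L⋆[ℂ] H)

theorem basisConj_self {H : Type*} [NormedAddCommGroup H] [InnerProductSpace ℂ H]
    {ι : Type*} (b : HilbertBasis ι ℂ H) (i : ι) : basisConj b (b i) = b i := by
  classical
  apply b.repr.injective
  ext j
  simp only [basisConj, LinearIsometryEquiv.trans_apply, LinearIsometryEquiv.apply_symm_apply,
    starₗᵢ_apply, lp.coeFn_star, Pi.star_apply, HilbertBasis.repr_self]
  by_cases h : j = i
  · subst h; simp
  · simp [h]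

theorem inner_basis_basisConj {H : Type*} [NormedAddCommGroup H] [InnerProductSpace ℂ H]
    {ι : Type*} (b : HilbertBasis ι ℂ H) (i : ι) (x : H) :
    inner ℂ (b i) (basisConj b x) = inner ℂ x (b i) := by
  rw [← b.repr_apply_apply]
  simp only [basisConj, LinearIsometryEquiv.trans_apply, LinearIsometryEquiv.apply_symm_apply,
    starₗᵢ_apply, lp.coeFn_star, Pi.star_apply, b.repr_apply_apply]
  exact inner_conj_symm _ _

/-- The matrix of the transpose is the transposed matrix. -/
theorem inner_basisTranspose {H : Type*} [NormedAddCommGroup H] [InnerProductSpace ℂ H]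
    [CompleteSpace H] {ι : Type*} (b : HilbertBasis ι ℂ H) (a : H →L[ℂ] H) (i j : ι) :
    inner ℂ (b i) (basisTranspose b a (b j)) = inner ℂ (b j) (a (b i)) := by
  change inner ℂ (b i) (basisConj b (ContinuousLinearMap.adjoint a (basisConj b (b j)))) = _
  rw [inner_basis_basisConj, basisConj_self, ContinuousLinearMap.adjoint_inner_left]

end

/-! A unital positive map that sends a projection `p` to a projection respects compression by `p`
and by `1 - p`, hence the Jordan product of `p` with every operator
(`mem_jordanDomain_of_isStarProjection`). As `k < dim H`, the rank `k` projections span all rank one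
operators, so these lie in the Jordan domain and in the range of `φ`.

Some `φ |v⟩⟨v|` is then a rank one projection `|w⟩⟨w|`. The Jordan identities force `φ |x⟩⟨v|` to be
`|Ux⟩⟨w|` for all `x`, or `|w⟩⟨Ux|` for all `x`, with `U` a linear, respectively conjugate-linear,
isometry. In both cases `φ |z⟩⟨z| = |Uz⟩⟨Uz|`, and compressing by it gives `⟨Uz, φ(a) Uz⟩ = ⟨z, a
z⟩` for unit `z` and every bounded `a`, so no continuity of `φ` beyond positivity is needed. Rank
one operators in the range make `U` onto. -/

open InnerProductSpace

/-! ### Jordan domain of a unital positive map -/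

namespace PositiveLinearMap

variable {A B : Type*} [CStarAlgebra A] [PartialOrder A] [StarOrderedRing A]
  [CStarAlgebra B] [PartialOrder B] [StarOrderedRing B]

theorem nonneg_of_forall_pos_smul_add_nonneg {a y : B} (h : ∀ t : ℝ, 0 < t → 0 ≤ t • a + y) :
    0 ≤ y := by
  have hlim : Filter.Tendsto (fun t : ℝ => t • a + y) (nhdsWithin 0 (Set.Ioi 0)) (nhds y) := by
    have hc : Continuous (fun t : ℝ => t • a + y) := by fun_prop
    have := hc.tendsto 0
    simp only [zero_smul, zero_add] at this
    exact this.mono_left nhdsWithin_le_nhds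
  exact CStarAlgebra.isClosed_nonneg.mem_of_tendsto hlim
    (Filter.eventually_of_mem self_mem_nhdsWithin fun t ht => h t ht)

theorem eq_zero_of_forall_sq_smul_add_smul_nonneg {a y : B}
    (h : ∀ t : ℝ, 0 ≤ t ^ 2 • a + t • y) : y = 0 := by
  have key : ∀ z : B, (∀ t : ℝ, 0 ≤ t ^ 2 • a + t • z) → 0 ≤ z := fun z hz =>
    nonneg_of_forall_pos_smul_add_nonneg fun t ht => by
      have := smul_nonneg (inv_nonneg.2 ht.le) (hz t)
      rwa [smul_add, smul_smul, smul_smul, sq, inv_mul_cancel_left₀ ht.ne',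
        inv_mul_cancel₀ ht.ne', one_smul] at this
  refine le_antisymm (neg_nonneg.1 (key (-y) fun t => ?_)) (key y h)
  simpa using h (-t)

variable (φ : A →ₚ[ℂ] B) {p : A}

/-- Since `0 ≤ p c p ≤ ‖c‖ p`, a rescaling of `φ (p c p)` lies below the projection `φ p`, hence in
its corner. -/
theorem conjugate_map_conjugate_of_nonneg (hp : IsStarProjection p)
    (hφp : IsStarProjection (φ p)) {c : A} (hc : 0 ≤ c) :
    φ p * φ (p * c * p) * φ p = φ (p * c * p) := by
  rcases eq_or_ne c 0 with rfl | hc0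
  · simp
  have hn : 0 < ‖c‖ := norm_pos_iff.2 hc0
  have h0 : 0 ≤ p * c * p := hp.isSelfAdjoint.conjugate_nonneg hc
  have h1 : p * c * p ≤ ‖c‖ • p := by
    simpa [hp.isSelfAdjoint.star_eq, hp.isIdempotentElem.eq] using
      CStarAlgebra.star_left_conjugate_le_norm_smul (a := p) (b := c) hc.isSelfAdjoint
  have h2 : φ (p * c * p) ≤ ‖c‖ • φ p := by
    rw [← φ.map_smul_of_tower]; exact OrderHomClass.mono φ h1
  have h3 := hφp.conjugate_of_nonneg_of_le (a := ‖c‖⁻¹ • φ (p * c * p))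
    (smul_nonneg (inv_nonneg.2 hn.le) (φ.map_nonneg h0))
    (by simpa [smul_smul, hn.ne'] using smul_le_smul_of_nonneg_left h2 (inv_nonneg.2 hn.le))
  rw [mul_smul_comm, smul_mul_assoc] at h3
  exact smul_right_injective B (inv_ne_zero hn.ne') h3

/-- A unital positive map commutes with compression by a projection whose image is again a
projection. -/
theorem map_conjugate (h1 : φ 1 = 1) (hp : IsStarProjection p) (hφp : IsStarProjection (φ p))
    (a : A) : φ (p * a * p) = φ p * φ a * φ p := by
  have hq : φ (1 - p) = 1 - φ p := by rw [map_sub, h1]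
  have hφq : IsStarProjection (φ (1 - p)) := hq ▸ hφp.one_sub
  have hpq : φ p * φ (1 - p) = 0 := by rw [hq]; exact hφp.mul_one_sub_self
  have key : ∀ c : A, 0 ≤ c → φ (p * c * p) = φ p * φ c * φ p := by
    intro c hc
    set x := p * c * (1 - p) + (1 - p) * c * p with hx
    have hB : φ p * φ ((1 - p) * c * (1 - p)) * φ p = 0 := by
      rw [← conjugate_map_conjugate_of_nonneg φ hp.one_sub hφq hc]
      simp only [← mul_assoc, hpq, zero_mul]
    have hA := conjugate_map_conjugate_of_nonneg φ hp hφp hc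
    -- Conjugating `c` by `t p + (1 - p)` gives a positive element; compressed by `φ p`, its image
    -- has no constant term in `t`, so the linear term must vanish.
    have hX : φ p * φ x * φ p = 0 := by
      refine eq_zero_of_forall_sq_smul_add_smul_nonneg (a := φ (p * c * p)) fun t => ?_
      have hs : IsSelfAdjoint (t • p + (1 - p)) :=
        ((IsSelfAdjoint.all t).smul hp.isSelfAdjoint).add hp.one_sub.isSelfAdjoint
      have he : (t • p + (1 - p)) * c * (t • p + (1 - p)) =
          t ^ 2 • (p * c * p) + t • x + (1 - p) * c * (1 - p) := by
        simp only [hx, add_mul, mul_add, smul_mul_assoc, mul_smul_comm, smul_smul, smul_add, sq]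
        abel
      have := hφp.isSelfAdjoint.conjugate_nonneg (φ.map_nonneg (hs.conjugate_nonneg hc))
      rw [he] at this
      simpa only [map_add, φ.map_smul_of_tower, mul_add, add_mul, mul_smul_comm, smul_mul_assoc,
        hA, hB, add_zero] using this
    have hc' : c = p * c * p + x + (1 - p) * c * (1 - p) := by rw [hx]; noncomm_ring
    conv_rhs => rw [hc']
    rw [map_add, map_add, mul_add, mul_add, add_mul, add_mul, hA, hX, hB, add_zero, add_zero]
  have hmem : a ∈ Submodule.span ℂ {a : A | 0 ≤ a} := by
    rw [CStarAlgebra.span_nonneg]; trivial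
  induction hmem using Submodule.span_induction with
  | mem x hx => exact key x hx
  | zero => simp
  | add x y _ _ hx hy => simp only [mul_add, add_mul, map_add, hx, hy]
  | smul r x _ hx => simp only [mul_smul_comm, smul_mul_assoc, map_smul, hx]

/-- The elements at which `φ` respects the Jordan product with every element. -/
def jordanDomain : Submodule ℂ A where
  carrier := {x | ∀ a, φ (x * a + a * x) = φ x * φ a + φ a * φ x}
  zero_mem' a := by simp
  add_mem' {x y} hx hy a := by
    have : (x + y) * a + a * (x + y) = (x * a + a * x) + (y * a + a * y) := by noncomm_ring
    rw [this, map_add, hx a, hy a, map_add]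
    noncomm_ring
  smul_mem' r x hx a := by
    have : (r • x) * a + a * (r • x) = r • (x * a + a * x) := by
      simp [smul_add]
    rw [this, map_smul, hx a, map_smul]
    simp [smul_add]

theorem mem_jordanDomain_of_isStarProjection (h1 : φ 1 = 1) (hp : IsStarProjection p)
    (hφp : IsStarProjection (φ p)) : p ∈ φ.jordanDomain := by
  intro a
  have hq : φ (1 - p) = 1 - φ p := by rw [map_sub, h1]
  have e1 := map_conjugate φ h1 hp hφp a
  have e2 := map_conjugate φ h1 hp.one_sub (hq ▸ hφp.one_sub) a
  have e3 : p * a + a * p = a + p * a * p - (1 - p) * a * (1 - p) := by noncomm_ring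
  rw [e3, map_sub, map_add, e1, e2, hq]
  noncomm_ring

theorem isStarProjection_map (hp : IsStarProjection p) (hpD : p ∈ φ.jordanDomain) :
    IsStarProjection (φ p) := by
  refine ⟨?_, ?_⟩
  · have h := hpD p
    rw [hp.isIdempotentElem.eq, ← two_smul ℂ, ← two_smul ℂ, map_smul] at h
    exact (smul_right_injective B (two_ne_zero (α := ℂ)) h).symm
  · exact (φ.map_nonneg hp.nonneg).isSelfAdjoint

end PositiveLinearMap

/-! ### Rank one operators and projections of rank `k` -/

section RankOne

variable {H : Type*} [NormedAddCommGroup H] [InnerProductSpace ℂ H]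

theorem rankOne_mul_rankOne (x y z w : H) :
    rankOne ℂ x y * rankOne ℂ z w = inner ℂ y z • rankOne ℂ x w :=
  rankOne_comp_rankOne x y z w

theorem rankOne_mul_mul_rankOne (x y z w : H) (a : H →L[ℂ] H) :
    rankOne ℂ x y * a * rankOne ℂ z w = inner ℂ y (a z) • rankOne ℂ x w := by
  ext u
  simp [smul_smul, mul_comm]

theorem exists_eq_smul_unit {x : H} (hx : x ≠ 0) :
    ∃ (c : ℝ) (v : H), ‖v‖ = 1 ∧ x = (c : ℂ) • v := by
  have hn : ‖x‖ ≠ 0 := norm_ne_zero_iff.2 hx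
  refine ⟨‖x‖, ((‖x‖⁻¹ : ℝ) : ℂ) • x, ?_, ?_⟩
  · rw [norm_smul]; simp [hn]
  · rw [smul_smul, ← Complex.ofReal_mul, mul_inv_cancel₀ hn]; simp

/-- Polarization: a space of operators containing all rank one projections contains all operators
of rank one. -/
theorem rankOne_mem_of_forall_unit_mem {D : Submodule ℂ (H →L[ℂ] H)}
    (hD : ∀ v : H, ‖v‖ = 1 → rankOne ℂ v v ∈ D) (x y : H) : rankOne ℂ x y ∈ D := by
  have hself : ∀ z : H, rankOne ℂ z z ∈ D := by
    intro z
    rcases eq_or_ne z 0 with rfl | hz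
    · simp
    obtain ⟨c, v, hv, rfl⟩ := exists_eq_smul_unit hz
    have h : rankOne ℂ ((c : ℂ) • v) ((c : ℂ) • v) = ((c : ℂ) * c) • rankOne ℂ v v := by
      rw [map_smulₛₗ, map_smulₛₗ, smul_apply, smul_smul, Complex.conj_ofReal, RingHom.id_apply]
    rw [h]
    exact D.smul_mem _ (hD v hv)
  have hpol : rankOne ℂ x y = (1 / 4 : ℂ) • (rankOne ℂ (x + y) (x + y) - rankOne ℂ (x - y) (x - y)
      + Complex.I • rankOne ℂ (x + Complex.I • y) (x + Complex.I • y)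
      - Complex.I • rankOne ℂ (x - Complex.I • y) (x - Complex.I • y)) := by
    simp only [map_add, map_sub, map_smul, map_smulₛₗ, add_apply,
      sub_apply, smul_apply, Complex.conj_I]
    simp only [smul_add, smul_sub, smul_smul]
    match_scalars <;> grind [Complex.I_mul_I]
  rw [hpol]
  exact D.smul_mem _ (D.sub_mem (D.add_mem (D.sub_mem (hself _) (hself _))
    (D.smul_mem _ (hself _))) (D.smul_mem _ (hself _)))

theorem ContinuousLinearMap.ext_inner_unit {S T : H →L[ℂ] H}
    (h : ∀ z : H, ‖z‖ = 1 → inner ℂ z (S z) = inner ℂ z (T z)) : S = T := by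
  refine ContinuousLinearMap.coe_injective ((ext_inner_map _ _).1 fun x => ?_)
  have hx' : inner ℂ x (S x) = inner ℂ x (T x) := by
    rcases eq_or_ne x 0 with rfl | hx
    · simp
    obtain ⟨c, v, hv, rfl⟩ := exists_eq_smul_unit hx
    simp [h v hv]
  simpa using congrArg (starRingEnd ℂ) hx'

variable [CompleteSpace H]

theorem sum_rankOne_mem_rankProjections {ι : Type*} {v : ι → H} (hv : Orthonormal ℂ v)
    (s : Finset ι) : ∑ i ∈ s, rankOne ℂ (v i) (v i) ∈ rankProjections H s.card := by
  classical
  let S : Submodule ℂ H := Submodule.span ℂ (s.image v : Set H)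
  let b : OrthonormalBasis s ℂ S := OrthonormalBasis.span hv s
  have : FiniteDimensional ℂ S := b.toBasis.finiteDimensional_of_finite
  have hb : S.starProjection = ∑ i ∈ s, rankOne ℂ (v i) (v i) := by
    rw [b.starProjection_eq_sum_rankOne, ← Finset.sum_coe_sort s]
    refine Finset.sum_congr rfl fun i _ => ?_
    have h : ((b i : S) : H) = v i := OrthonormalBasis.span_apply hv s i
    rw [h]
  rw [← hb]
  refine ⟨isStarProjection_starProjection, ?_⟩
  have hr : LinearMap.range (S.starProjection : H →ₗ[ℂ] H) = S := S.range_starProjection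
  rw [LinearMap.rank, hr, rank_eq_card_basis b.toBasis, Fintype.card_coe]

theorem exists_orthonormal_finset {k : ℕ} (hk : (k : Cardinal) < Module.rank ℂ H) {v : H}
    (hv : ‖v‖ = 1) : ∃ (w : Set H) (_ : Orthonormal ℂ ((↑) : w → H)) (s : Finset w) (i : w),
      i ∈ s ∧ (i : H) = v ∧ s.card = k + 1 := by
  have hs : Orthonormal ℂ ((↑) : ({v} : Set H) → H) := by
    refine ⟨fun i => ?_, fun i j hij => (hij (Subsingleton.elim i j)).elim⟩
    have : (i : H) = v := i.2
    rw [this, hv]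
  obtain ⟨w, b, hw, hbw⟩ := hs.exists_hilbertBasis_extension
  refine ⟨w, hbw ▸ b.orthonormal, ?_⟩
  have hvw : v ∈ w := hw rfl
  suffices ∃ s : Finset w, {⟨v, hvw⟩} ⊆ s ∧ s.card = k + 1 by
    obtain ⟨s, hs, hc⟩ := this
    exact ⟨s, ⟨v, hvw⟩, hs (Finset.mem_singleton_self _), rfl, hc⟩
  rcases finite_or_infinite w with hf | hf
  · have := Fintype.ofFinite w
    refine Finset.exists_superset_card_eq (by simp) ?_
    rw [rank_eq_card_basis b.toOrthonormalBasis.toBasis] at hk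
    exact_mod_cast hk
  · exact Infinite.exists_superset_card_eq _ _ (by simp)

/-- Extend `v` to `k + 1` orthonormal vectors, with total projection `e`. Omitting one vector leaves
a rank `k` projection, and these `k + 1` projections sum to `k e`. So `e` is in the span, and
subtracting the projection that omits `v` isolates `|v⟩⟨v|`. -/
theorem rankOne_self_mem_span_rankProjections {k : ℕ} (hk0 : 1 ≤ k)
    (hk : (k : Cardinal) < Module.rank ℂ H) {v : H} (hv : ‖v‖ = 1) :
    rankOne ℂ v v ∈ Submodule.span ℂ (rankProjections H k) := by
  classical
  obtain ⟨w, hw, s, i, his, rfl, hs⟩ := exists_orthonormal_finset hk hv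
  have hmem : ∀ j ∈ s, ∑ l ∈ s, rankOne ℂ (l : H) (l : H) - rankOne ℂ (j : H) (j : H) ∈
      rankProjections H k := by
    intro j hj
    rw [← Finset.sum_erase_eq_sub hj]
    simpa [Finset.card_erase_of_mem hj, hs] using sum_rankOne_mem_rankProjections hw (s.erase j)
  set e := ∑ l ∈ s, rankOne ℂ (l : H) (l : H) with he
  have hsum : ∑ j ∈ s, (e - rankOne ℂ (j : H) (j : H)) = (k : ℂ) • e := by
    rw [Finset.sum_sub_distrib, ← he, Finset.sum_const, hs, ← Nat.cast_smul_eq_nsmul ℂ]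
    push_cast
    rw [add_smul, one_smul, add_sub_cancel_right]
  have hk' : (k : ℂ) ≠ 0 := by exact_mod_cast (by omega : k ≠ 0)
  have h : rankOne ℂ (i : H) (i : H) =
      (k : ℂ)⁻¹ • ∑ j ∈ s, (e - rankOne ℂ (j : H) (j : H)) - (e - rankOne ℂ (i : H) (i : H)) := by
    rw [hsum, smul_smul, inv_mul_cancel₀ hk', one_smul, sub_sub_cancel]
  rw [h]
  exact Submodule.sub_mem _ (Submodule.smul_mem _ _ (Submodule.sum_mem _ fun j hj =>
    Submodule.subset_span (hmem j hj))) (Submodule.subset_span (hmem i his))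

end RankOne

/-! ### Coordinate conjugation and the transpose -/

section BasisConj

variable {H : Type*} [NormedAddCommGroup H] [InnerProductSpace ℂ H] {ι : Type*}
  (b : HilbertBasis ι ℂ H)

theorem inner_basisConj_comm (x y : H) :
    inner ℂ x (basisConj b y) = inner ℂ y (basisConj b x) := by
  rw [← b.tsum_inner_mul_inner, ← b.tsum_inner_mul_inner y]
  simp only [inner_basis_basisConj, mul_comm]

theorem inner_basisTranspose_self [CompleteSpace H] (a : H →L[ℂ] H) (z : H) :
    inner ℂ z (basisTranspose b a z) = inner ℂ (basisConj b z) (a (basisConj b z)) := by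
  change inner ℂ z (basisConj b (ContinuousLinearMap.adjoint a (basisConj b z))) = _
  rw [inner_basisConj_comm, ContinuousLinearMap.adjoint_inner_left]

end BasisConj

/-! ### The isometry implementing `φ` -/

section

variable {H : Type*} [NormedAddCommGroup H] [InnerProductSpace ℂ H]
  {φ : (H →L[ℂ] H) →ₚ[ℂ] (H →L[ℂ] H)}

namespace PositiveLinearMap

/-- If `φ a = |y⟩⟨y|`, the quadratic form of `a` at a unit `z` is `|⟨y, W z⟩|² = 0`, so `a = 0`. -/
theorem eq_zero_of_forall_inner_eq_zero (hsurj : ∀ x, ∃ a, φ a = rankOne ℂ x x) {W : H → H}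
    (hW : ∀ z, ‖z‖ = 1 → ∀ a, inner ℂ (W z) (φ a (W z)) = inner ℂ z (a z)) {y : H}
    (hy : ∀ z, ‖z‖ = 1 → inner ℂ y (W z) = 0) : y = 0 := by
  obtain ⟨a, ha⟩ := hsurj y
  have h0 : a = 0 := ContinuousLinearMap.ext_inner_unit fun z hz => by
    rw [← hW z hz, ha]
    simp [hy z hz]
  rw [h0, map_zero] at ha
  simpa using rankOne_eq_zero.1 ha.symm

variable [CompleteSpace H] (φ)

theorem inner_map_apply_of_map_rankOne_self (h1 : φ 1 = 1) {v w : H} (hv : ‖v‖ = 1)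
    (hw : ‖w‖ = 1) (hvw : φ (rankOne ℂ v v) = rankOne ℂ w w) (a : H →L[ℂ] H) :
    inner ℂ w (φ a w) = inner ℂ v (a v) := by
  have h := map_conjugate φ h1 (isStarProjection_rankOne_self hv)
    (hvw ▸ isStarProjection_rankOne_self hw) a
  rw [rankOne_mul_mul_rankOne, map_smul, hvw, rankOne_mul_mul_rankOne] at h
  have h2 := congrArg (fun T : H →L[ℂ] H => inner ℂ w (T w)) h
  simpa [inner_self_eq_one_of_norm_eq_one hw, hw] using h2.symm

/-- Take a unit `w` in the range of `f = φ |v⟩⟨v|` and `a` with `φ a = |w⟩⟨w|`. Compression gives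
`|w⟩⟨w| = f (φ a) f = ⟨v, a v⟩ f`, and evaluation at `w` shows that the scalar is `1`. -/
theorem exists_map_rankOne_self_eq_rankOne_self (h1 : φ 1 = 1)
    (hsurj : ∀ x, ∃ a, φ a = rankOne ℂ x x) {v : H} (hv : ‖v‖ = 1)
    (hf : IsStarProjection (φ (rankOne ℂ v v))) (h0 : φ (rankOne ℂ v v) ≠ 0) :
    ∃ w : H, ‖w‖ = 1 ∧ φ (rankOne ℂ v v) = rankOne ℂ w w := by
  set f := φ (rankOne ℂ v v) with hfdef
  obtain ⟨z, hz⟩ : ∃ z, f z ≠ 0 := by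
    by_contra! h
    exact h0 (ContinuousLinearMap.ext h)
  obtain ⟨c, w, hw, hcw⟩ := exists_eq_smul_unit hz
  have hc : (c : ℂ) ≠ 0 := by
    rintro hc
    exact hz (by rw [hcw, hc, zero_smul])
  have hfw : f w = w := by
    have hff : f (f z) = f z := congrArg (fun T : H →L[ℂ] H => T z) hf.isIdempotentElem.eq
    rw [hcw, map_smul] at hff
    exact smul_right_injective H hc hff
  refine ⟨w, hw, ?_⟩
  obtain ⟨a, ha⟩ := hsurj w
  have h := map_conjugate φ h1 (isStarProjection_rankOne_self hv) hf a
  rw [rankOne_mul_mul_rankOne, map_smul, ha, ← hfdef] at h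
  have hfa : ContinuousLinearMap.adjoint f = f := hf.isSelfAdjoint.star_eq
  have hR : f * rankOne ℂ w w * f = rankOne ℂ w w := by
    ext u
    simp only [mul_apply_eq_comp, rankOne_apply, map_smul, hfw]
    rw [← ContinuousLinearMap.adjoint_inner_left, hfa, hfw]
  rw [hR] at h
  have h2 := congrArg (fun T : H →L[ℂ] H => inner ℂ w (T w)) h
  simp only [_root_.smul_apply, hfw, rankOne_apply, inner_smul_right,
    inner_self_eq_one_of_norm_eq_one hw, mul_one] at h2
  rw [← h, h2, one_smul]

variable {φ} {v w : H}

/-- If `φ` sends `|v⟩⟨v|` to `|w⟩⟨w|`, then `φ |x⟩⟨v|` has either row space or column space spanned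
by `w`, for every `x ⟂ v`. -/
theorem map_rankOne_mul_eq_zero_or (h1 : φ 1 = 1) (hD : ∀ x y, rankOne ℂ x y ∈ φ.jordanDomain)
    (hv : ‖v‖ = 1) (hw : ‖w‖ = 1) (hvw : φ (rankOne ℂ v v) = rankOne ℂ w w) {x : H}
    (hx : inner ℂ v x = 0) :
    φ (rankOne ℂ x v) * rankOne ℂ w w = 0 ∨ rankOne ℂ w w * φ (rankOne ℂ x v) = 0 := by
  have hf := isStarProjection_rankOne_self (𝕜 := ℂ) hw
  set f := rankOne ℂ w w with hfdef
  set T := φ (rankOne ℂ x v) with hT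
  have hTf : T = f * T + T * f := by
    have h := hD v v (rankOne ℂ x v)
    rw [rankOne_mul_rankOne, rankOne_mul_rankOne, hx, zero_smul, zero_add,
      inner_self_eq_one_of_norm_eq_one hv, one_smul, hvw] at h
    exact h
  have hTT : T * T = 0 := by
    have h := hD x v (rankOne ℂ x v)
    rw [rankOne_mul_rankOne, hx, zero_smul, add_zero, map_zero, ← two_smul ℂ] at h
    exact (smul_eq_zero.1 h.symm).resolve_left two_ne_zero
  have hfTf : inner ℂ w (T w) = 0 := by
    rw [inner_map_apply_of_map_rankOne_self φ h1 hv hw hvw]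
    simp [hx]
  set β := ContinuousLinearMap.adjoint T w with hβ
  have hwβ : inner ℂ w β = 0 := by
    rw [hβ, ContinuousLinearMap.adjoint_inner_right, ← inner_conj_symm, hfTf, map_zero]
  have hTapply : ∀ u, T u = inner ℂ β u • w + inner ℂ w u • T w := by
    intro u
    conv_lhs => rw [hTf]
    simp [hfdef, hβ, ContinuousLinearMap.adjoint_inner_left]
  -- With `T = |w⟩⟨β| + |Tw⟩⟨w|` and `β ⟂ w`, this reads `‖β‖² T w = 0`.
  have hTTβ : T (T β) = 0 := congrArg (fun S : H →L[ℂ] H => S β) hTT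
  rw [hTapply β, hwβ, zero_smul, add_zero, map_smul, smul_eq_zero, inner_self_eq_zero] at hTTβ
  rcases hTTβ with h | h
  · right
    ext u
    have : inner ℂ w (T u) = 0 := by
      rw [← ContinuousLinearMap.adjoint_inner_left, ← hβ, h, inner_zero_left]
    simp [hfdef, this]
  · left
    ext u
    simp [hfdef, h]

/-- The choice is uniform in `x` because a vector space is not the union of two proper subspaces;
the component of `x` along `v` only adds a multiple of `|w⟩⟨w|`. -/
theorem map_rankOne_mul_eq_or (h1 : φ 1 = 1) (hD : ∀ x y, rankOne ℂ x y ∈ φ.jordanDomain)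
    (hv : ‖v‖ = 1) (hw : ‖w‖ = 1) (hvw : φ (rankOne ℂ v v) = rankOne ℂ w w) :
    (∀ x, φ (rankOne ℂ x v) * rankOne ℂ w w = φ (rankOne ℂ x v)) ∨
      (∀ x, rankOne ℂ w w * φ (rankOne ℂ x v) = φ (rankOne ℂ x v)) := by
  have hf := (isStarProjection_rankOne_self (𝕜 := ℂ) hw).isIdempotentElem.eq
  have hdich := fun x (hx : inner ℂ v x = 0) => map_rankOne_mul_eq_zero_or h1 hD hv hw hvw hx
  have hTf : ∀ x, inner ℂ v x = 0 → φ (rankOne ℂ x v) =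
      rankOne ℂ w w * φ (rankOne ℂ x v) + φ (rankOne ℂ x v) * rankOne ℂ w w := by
    intro x hx
    have h := hD v v (rankOne ℂ x v)
    rw [rankOne_mul_rankOne, rankOne_mul_rankOne, hx, zero_smul, zero_add,
      inner_self_eq_one_of_norm_eq_one hv, one_smul, hvw] at h
    exact h
  have hdec : ∀ x, ∃ (y : H) (c : ℂ), inner ℂ v y = 0 ∧
      φ (rankOne ℂ x v) = φ (rankOne ℂ y v) + c • rankOne ℂ w w := by
    intro x
    refine ⟨x - inner ℂ v x • v, inner ℂ v x, ?_, ?_⟩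
    · rw [inner_sub_right, inner_smul_right, inner_self_eq_one_of_norm_eq_one hv, mul_one, sub_self]
    · rw [← hvw, ← map_smul, ← map_add]
      congr 1
      simp
  have hunion : (∀ x, inner ℂ v x = 0 → rankOne ℂ w w * φ (rankOne ℂ x v) = 0) ∨
      (∀ x, inner ℂ v x = 0 → φ (rankOne ℂ x v) * rankOne ℂ w w = 0) := by
    by_contra! ⟨⟨x, hx, hx0⟩, ⟨y, hy, hy0⟩⟩
    have hx1 := (hdich x hx).resolve_right hx0
    have hy1 := (hdich y hy).resolve_left hy0
    have hxy := hdich (x + y) (by rw [inner_add_right, hx, hy, add_zero])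
    rw [map_add, _root_.add_apply, map_add, add_mul, mul_add, hx1, hy1, zero_add, add_zero] at hxy
    exact hxy.elim hy0 hx0
  refine hunion.imp (fun h x => ?_) (fun h x => ?_)
  · obtain ⟨y, c, hy, hxy⟩ := hdec x
    have := hTf y hy
    rw [h y hy, zero_add] at this
    rw [hxy, add_mul, ← this, smul_mul_assoc, hf]
  · obtain ⟨y, c, hy, hxy⟩ := hdec x
    have := hTf y hy
    rw [h y hy, add_zero] at this
    rw [hxy, mul_add, ← this, mul_smul_comm, hf]

/-- Serves the linear and the conjugate-linear case alike, since `hxy` does not see the order of the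
factors in the Jordan product. Evaluating `hxy` at `w` gives the norms; cancelling the `|w⟩⟨w|` term
leaves `φ |x⟩⟨x| = |y⟩⟨y|`. -/
theorem norm_eq_and_inner_map_apply_eq (h1 : φ 1 = 1) (hv : ‖v‖ = 1) (hw : ‖w‖ = 1)
    (hvw : φ (rankOne ℂ v v) = rankOne ℂ w w) {x y : H}
    (hxy : φ (rankOne ℂ x x + inner ℂ x x • rankOne ℂ v v) =
      rankOne ℂ y y + inner ℂ y y • rankOne ℂ w w)
    (hn : ‖inner ℂ v x‖ = ‖inner ℂ w y‖) :
    ‖y‖ = ‖x‖ ∧ (‖x‖ = 1 → ∀ a, inner ℂ y (φ a y) = inner ℂ x (a x)) := by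
  have hsq : ∀ z u : H, inner ℂ z u * inner ℂ u z = ((‖inner ℂ u z‖ ^ 2 : ℝ) : ℂ) := fun z u => by
    rw [← inner_conj_symm z u, Complex.conj_mul', Complex.ofReal_pow]
  have key := inner_map_apply_of_map_rankOne_self φ h1 hv hw hvw
    (rankOne ℂ x x + inner ℂ x x • rankOne ℂ v v)
  rw [hxy] at key
  simp only [_root_.add_apply, _root_.smul_apply, rankOne_apply, inner_add_right, inner_smul_right,
    inner_self_eq_one_of_norm_eq_one hv, inner_self_eq_one_of_norm_eq_one hw, mul_one, hsq,
    hn] at key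
  have hself : inner ℂ y y = inner ℂ x x := add_left_cancel key
  have hnorm : ‖y‖ = ‖x‖ := by
    rw [norm_eq_sqrt_re_inner (𝕜 := ℂ), hself, ← norm_eq_sqrt_re_inner]
  refine ⟨hnorm, fun hx a => ?_⟩
  rw [map_add, map_smul, hvw, hself] at hxy
  exact inner_map_apply_of_map_rankOne_self φ h1 hx (hnorm.trans hx) (add_right_cancel hxy) a

theorem map_rankOne_swap (x y : H) :
    φ (rankOne ℂ y x) = ContinuousLinearMap.adjoint (φ (rankOne ℂ x y)) := by
  rw [← adjoint_rankOne]
  exact map_star φ (rankOne ℂ x y)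

theorem map_rankOne_self_add (hD : ∀ x y, rankOne ℂ x y ∈ φ.jordanDomain) (hv : ‖v‖ = 1) (x : H) :
    φ (rankOne ℂ x x + inner ℂ x x • rankOne ℂ v v) =
      φ (rankOne ℂ x v) * ContinuousLinearMap.adjoint (φ (rankOne ℂ x v)) +
      ContinuousLinearMap.adjoint (φ (rankOne ℂ x v)) * φ (rankOne ℂ x v) := by
  rw [← map_rankOne_swap, ← hD x v, rankOne_mul_rankOne, rankOne_mul_rankOne,
    inner_self_eq_one_of_norm_eq_one hv, one_smul]

theorem exists_linearIsometry_or_exists_conjLinearIsometry (h1 : φ 1 = 1)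
    (hD : ∀ x y, rankOne ℂ x y ∈ φ.jordanDomain)
    (hv : ‖v‖ = 1) (hw : ‖w‖ = 1) (hvw : φ (rankOne ℂ v v) = rankOne ℂ w w) :
    (∃ U : H →ₗᵢ[ℂ] H, ∀ z, ‖z‖ = 1 → ∀ a, inner ℂ (U z) (φ a (U z)) = inner ℂ z (a z)) ∨
    (∃ V : H →ₗᵢ⋆[ℂ] H, ∀ z, ‖z‖ = 1 → ∀ a, inner ℂ (V z) (φ a (V z)) = inner ℂ z (a z)) := by
  have hww := inner_self_eq_one_of_norm_eq_one (𝕜 := ℂ) hw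
  have hinner : ∀ x, inner ℂ w (φ (rankOne ℂ x v) w) = inner ℂ v x := fun x => by
    rw [inner_map_apply_of_map_rankOne_self φ h1 hv hw hvw]
    simp [hv]
  refine (map_rankOne_mul_eq_or h1 hD hv hw hvw).imp (fun h => ?_) (fun h => ?_)
  · have key : ∀ x, _ := fun x => norm_eq_and_inner_map_apply_eq (x := x)
      (y := φ (rankOne ℂ x v) w) h1 hv hw hvw (by
        have hT : φ (rankOne ℂ x v) = rankOne ℂ (φ (rankOne ℂ x v) w) w := by
          rw [← comp_rankOne]; exact (h x).symm
        rw [map_rankOne_self_add hD hv]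
        generalize φ (rankOne ℂ x v) w = y at hT
        rw [hT, adjoint_rankOne, rankOne_mul_rankOne, rankOne_mul_rankOne, hww, one_smul])
      (by rw [hinner])
    exact ⟨{  toFun := fun x => φ (rankOne ℂ x v) w
              map_add' := fun x y => by simp
              map_smul' := fun c x => by simp
              norm_map' := fun x => (key x).1 }, fun z hz => (key z).2 hz⟩
  · have key : ∀ x, _ := fun x => norm_eq_and_inner_map_apply_eq (x := x)
      (y := ContinuousLinearMap.adjoint (φ (rankOne ℂ x v)) w) h1 hv hw hvw (by
        have hT : φ (rankOne ℂ x v) =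
            rankOne ℂ w (ContinuousLinearMap.adjoint (φ (rankOne ℂ x v)) w) := by
          rw [← rankOne_comp]; exact (h x).symm
        rw [map_rankOne_self_add hD hv]
        generalize ContinuousLinearMap.adjoint (φ (rankOne ℂ x v)) w = y at hT
        rw [hT, adjoint_rankOne, rankOne_mul_rankOne, rankOne_mul_rankOne, hww, one_smul,
          add_comm])
      (by rw [ContinuousLinearMap.adjoint_inner_right, ← hinner, norm_inner_symm])
    exact ⟨{  toFun := fun x => ContinuousLinearMap.adjoint (φ (rankOne ℂ x v)) w
              map_add' := fun x y => by simp
              map_smul' := fun c x => by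
                rw [map_smul, _root_.smul_apply, map_smul]
                exact congrArg (fun T : H →L[ℂ] H => T w) (star_smul c (φ (rankOne ℂ x v)))
              norm_map' := fun x => (key x).1 }, fun z hz => (key z).2 hz⟩

/-- The range of `U` is closed with trivial orthogonal complement, so `U` is unitary. `θ` is the
identity or the transpose. -/
theorem exists_unitary_of_linearIsometry (θ : (H →L[ℂ] H) → (H →L[ℂ] H)) (U : H →ₗᵢ[ℂ] H)
    (hU : ∀ z, ‖z‖ = 1 → ∀ a, inner ℂ (U z) (φ a (U z)) = inner ℂ z (θ a z))
    (hperp : ∀ y, (∀ z, ‖z‖ = 1 → inner ℂ y (U z) = 0) → y = 0) :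
    ∃ u ∈ unitary (H →L[ℂ] H), ∀ a, φ a = u * θ a * star u := by
  have hclosed : IsClosed (LinearMap.range U.toLinearMap : Set H) := by
    rw [LinearMap.coe_range]
    exact U.isometry.isClosedEmbedding.isClosed_range
  have hsurj : Function.Surjective U := by
    have : CompleteSpace (LinearMap.range U.toLinearMap) := hclosed.completeSpace_coe
    refine LinearMap.range_eq_top.1 ((Submodule.orthogonal_eq_bot_iff).1
      (Submodule.eq_bot_iff _ |>.2 fun y hy => hperp y fun z _ => ?_))
    exact (Submodule.mem_orthogonal' _ _).1 hy _ ⟨z, rfl⟩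
  let u := Unitary.linearIsometryEquiv.symm (LinearIsometryEquiv.ofSurjective U hsurj)
  have hu : ∀ z, (u : H →L[ℂ] H) z = U z := fun z => rfl
  refine ⟨u, u.2, fun a => ?_⟩
  have h : star (u : H →L[ℂ] H) * φ a * u = θ a := ContinuousLinearMap.ext_inner_unit fun z hz => by
    rw [← hU z hz, ← hu z]
    exact ContinuousLinearMap.adjoint_inner_right _ _ _
  have huu := Unitary.mul_star_self_of_mem u.2
  rw [← h]
  simp only [← mul_assoc, huu, one_mul]
  rw [mul_assoc, huu, mul_one]

end PositiveLinearMap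

end

theorem theorem2 {H : Type*} [NormedAddCommGroup H] [InnerProductSpace ℂ H] [CompleteSpace H]
    {ι : Type*} (b : HilbertBasis ι ℂ H)
    (φ : (H →L[ℂ] H) →ₚ[ℂ] (H →L[ℂ] H)) (hunital : φ 1 = 1)
    (k : ℕ) (hk_pos : 1 ≤ k) (hk_lt : (k : Cardinal) < Module.rank ℂ H)
    (hφ : φ '' rankProjections H k = rankProjections H k) :
    ∃ U ∈ unitary (H →L[ℂ] H),
      (∀ a : H →L[ℂ] H, φ a = U * a * star U) ∨
      (∀ a : H →L[ℂ] H, φ a = U * basisTranspose b a * star U) := by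
  have hspan : ∀ x y : H, rankOne ℂ x y ∈ Submodule.span ℂ (rankProjections H k) :=
    rankOne_mem_of_forall_unit_mem fun v hv =>
      rankOne_self_mem_span_rankProjections hk_pos hk_lt hv
  have hD : ∀ x y : H, rankOne ℂ x y ∈ φ.jordanDomain := fun x y => by
    refine (Submodule.span_le.2 fun p hp => ?_) (hspan x y)
    exact φ.mem_jordanDomain_of_isStarProjection hunital hp.1
      (hφ.subset (Set.mem_image_of_mem φ hp)).1
  have hsurj : ∀ x : H, ∃ a, φ a = rankOne ℂ x x := fun x => by
    have hle : Submodule.span ℂ (rankProjections H k) ≤ LinearMap.range φ.toLinearMap :=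
      Submodule.span_le.2 fun p hp => by
        obtain ⟨a, _, ha⟩ := hφ.superset hp
        exact ⟨a, ha⟩
    exact hle (hspan x x)
  -- Otherwise `φ` would kill a rank `k` projection, whose image has rank `k ≥ 1`.
  obtain ⟨v, hv, hv0⟩ : ∃ v : H, ‖v‖ = 1 ∧ φ (rankOne ℂ v v) ≠ 0 := by
    by_contra! h0
    have : Nontrivial H := by
      rw [← rank_pos_iff_nontrivial (R := ℂ)]
      exact bot_le.trans_lt hk_lt
    obtain ⟨x, hx⟩ := exists_ne (0 : H)
    obtain ⟨c, v, hv, -⟩ := exists_eq_smul_unit hx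
    obtain ⟨w, hw, s, i, -, -, hs⟩ := exists_orthonormal_finset hk_lt hv
    obtain ⟨t, -, ht⟩ := Finset.exists_subset_card_eq (s := s) (n := k) (by omega)
    have hmem := hφ.subset (Set.mem_image_of_mem φ (ht ▸ sum_rankOne_mem_rankProjections hw t))
    rw [map_sum, Finset.sum_eq_zero fun j (_ : j ∈ t) => h0 (j : H) (hw.1 j)] at hmem
    have hrank := hmem.2
    rw [ContinuousLinearMap.toLinearMap_zero, LinearMap.rank_zero] at hrank
    have : k = 0 := by exact_mod_cast hrank.symm
    omega
  obtain ⟨w, hw, hvw⟩ := φ.exists_map_rankOne_self_eq_rankOne_self hunital hsurj hv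
    (φ.isStarProjection_map (isStarProjection_rankOne_self hv) (hD v v)) hv0
  rcases PositiveLinearMap.exists_linearIsometry_or_exists_conjLinearIsometry hunital hD hv hw hvw
    with ⟨U, hU⟩ | ⟨V, hV⟩
  · obtain ⟨u, hu, h⟩ := PositiveLinearMap.exists_unitary_of_linearIsometry id U hU fun y hy =>
      PositiveLinearMap.eq_zero_of_forall_inner_eq_zero hsurj hU hy
    exact ⟨u, hu, Or.inl h⟩
  · have hJ : ∀ z, ‖z‖ = 1 → ‖basisConj b z‖ = 1 := fun z hz => by
      rw [LinearIsometryEquiv.norm_map, hz]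
    -- Composing `V` with coordinate conjugation makes it linear and turns `a` into its transpose.
    obtain ⟨u, hu, h⟩ := PositiveLinearMap.exists_unitary_of_linearIsometry (φ := φ)
      (basisTranspose b) (V.comp (basisConj b).toLinearIsometry)
      (fun z hz a => by
        rw [inner_basisTranspose_self]
        exact hV _ (hJ z hz) a)
      (fun y hy => PositiveLinearMap.eq_zero_of_forall_inner_eq_zero hsurj hV fun z hz => by
        have := hy ((basisConj b).symm z) (by rw [LinearIsometryEquiv.norm_map, hz])
        simpa using this)
    exact ⟨u, hu, Or.inr h⟩
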